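/- Let $n\in\mathbb N$ and let $\mathcal A\subseteq M_n(\mathbb C)$ be a unital $*$-subalgebra (for example $\mathcal A=M_n(\mathbb C)$). Let $\mathcal A_\infty=\bigotimes_{k=1}^\infty\mathcal A$ be the infinite C*-algebraic tensor product, that is, the C*-inductive limit of the algebras $\mathcal A^{\otimes m}$ under the embeddings $x\mapsto x\otimes 1$. A state on a unital $*$-algebra is a linear functional $\varphi$ with $\varphi(1)=1$ and $\varphi(x^*x)\ge 0$ for all $x$. Let $S_{P,\mathcal A_\infty}$ be the convex set of all states on $\mathcal A_\infty$ that are invariant under the action of the group of finite permutations of the tensor factors. Let $\rho$ be a state on $\mathcal A$. Then there is exactly one state $\prod\rho=\rho^{\otimes\infty}$ on $\mathcal A_\infty$ with $$\Big(\prod\rho\Big)(a_1\otimes a_2\otimes\cdots\otimes a_m\otimes 1\otimes 1\otimes\cdots)=\rho(a_1)\rho(a_2)\cdots\rho(a_m)\qquad(m\in\mathbb N,\ a_1,\dots,a_m\in\mathcal A),$$ and this product state $\prod\rho$ is an extreme point of $S_{P,\mathcal A_\infty}$. -/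

import Mathlib

open scoped ComplexOrder

noncomputable section

namespace InfTensor

/-- The Hilbert space `ℓ²` with orthonormal basis the configurations `f : ℕ → Fin n`
(one basis index of `ℂⁿ` at every site `k : ℕ`). -/
abbrev ConfigSpace (n : ℕ) : Type := lp (fun _ : ℕ → Fin n => ℂ) 2

theorem norm_sq_eq {n : ℕ} (ψ : ConfigSpace n) : ‖ψ‖ ^ 2 = ∑' f, ‖ψ f‖ ^ 2 := by
  have h := lp.norm_rpow_eq_tsum (p := 2) (by norm_num) ψ
  simpa using h

theorem summable_norm_sq {n : ℕ} (ψ : ConfigSpace n) : Summable fun f => ‖ψ f‖ ^ 2 := by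
  have h := (lp.memℓp ψ).summable (by norm_num)
  simpa using h

theorem memℓp_of_summable {n : ℕ} {ψ : (ℕ → Fin n) → ℂ} (h : Summable fun f => ‖ψ f‖ ^ 2) :
    Memℓp ψ 2 := by
  apply memℓp_gen
  simpa using h

/-- The bijection between configurations with value `i` at site `k` and those with value `j`
there that changes the value at site `k` only. -/
def updateEquiv {n : ℕ} (k : ℕ) (i j : Fin n) :
    {f : ℕ → Fin n // f k = i} ≃ {f : ℕ → Fin n // f k = j} where
  toFun f := ⟨Function.update f.1 k j, by simp⟩
  invFun f := ⟨Function.update f.1 k i, by simp⟩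
  left_inv f := by
    apply Subtype.ext
    simp [← f.2]
  right_inv f := by
    apply Subtype.ext
    simp [← f.2]

theorem matUnit_aux {n : ℕ} (k : ℕ) (i j : Fin n) (ψ : ConfigSpace n) :
    (Summable fun f : ℕ → Fin n => ‖if f k = i then ψ (Function.update f k j) else 0‖ ^ 2) ∧
    ∑' f : ℕ → Fin n, ‖if f k = i then ψ (Function.update f k j) else 0‖ ^ 2 ≤ ‖ψ‖ ^ 2 := by
  have e1 : (fun f : ℕ → Fin n => ‖if f k = i then ψ (Function.update f k j) else 0‖ ^ 2) =
      Set.indicator {f : ℕ → Fin n | f k = i} fun f => ‖ψ (Function.update f k j)‖ ^ 2 := by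
    funext f
    by_cases h : f k = i <;> simp [h]
  have hinj : Function.Injective
      fun f : {f : ℕ → Fin n // f k = i} => (updateEquiv k i j f).1 :=
    Subtype.val_injective.comp (updateEquiv k i j).injective
  have hs : Summable ((fun f => ‖ψ f‖ ^ 2) ∘
      fun f : {f : ℕ → Fin n // f k = i} => (updateEquiv k i j f).1) :=
    (summable_norm_sq ψ).comp_injective hinj
  rw [e1]
  refine ⟨summable_subtype_iff_indicator.1 hs, ?_⟩
  rw [← tsum_subtype, norm_sq_eq]
  exact Summable.tsum_le_tsum_of_inj _ hinj (fun _ _ => by positivity) (fun _ => le_rfl) hs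
    (summable_norm_sq ψ)

/-- The matrix unit `e_{ij}` acting at site `k`: it sends the basis vector of a configuration
with value `j` at site `k` to that of the configuration with this value changed to `i`, and
kills the other basis vectors. -/
def matUnit {n : ℕ} (k : ℕ) (i j : Fin n) : ConfigSpace n →L[ℂ] ConfigSpace n :=
  LinearMap.mkContinuous
    { toFun := fun ψ => ⟨fun f => if f k = i then ψ (Function.update f k j) else 0,
        memℓp_of_summable (matUnit_aux k i j ψ).1⟩
      map_add' := fun ψ χ => by
        ext f
        change (if f k = i then (ψ + χ) (Function.update f k j) else 0) =
          (if f k = i then ψ (Function.update f k j) else 0) +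
            (if f k = i then χ (Function.update f k j) else 0)
        by_cases h : f k = i <;> simp [h]
      map_smul' := fun c ψ => by
        ext f
        by_cases h : f k = i <;> simp [h] } 1 (fun ψ => by
      rw [one_mul]
      refine le_of_sq_le_sq ?_ (norm_nonneg _)
      rw [norm_sq_eq]
      exact (matUnit_aux k i j ψ).2)

theorem matUnit_apply {n : ℕ} (k : ℕ) (i j : Fin n) (ψ : ConfigSpace n) (f : ℕ → Fin n) :
    matUnit k i j ψ f = if f k = i then ψ (Function.update f k j) else 0 := rfl

theorem matUnit_mul {n : ℕ} (k : ℕ) (i j l m : Fin n) :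
    matUnit k i j * matUnit k l m = if j = l then matUnit k i m else 0 := by
  ext ψ f
  by_cases h : f k = i <;> by_cases h' : j = l <;> simp [matUnit_apply, h, h']

theorem sum_matUnit {n : ℕ} (k : ℕ) : ∑ i : Fin n, matUnit k i i = 1 := by
  ext ψ f
  rw [sum_apply, lp.coeFn_sum, Finset.sum_apply]
  simp [matUnit_apply]

theorem star_matUnit {n : ℕ} (k : ℕ) (i j : Fin n) :
    star (matUnit k i j) = matUnit k j i := by
  rw [ContinuousLinearMap.star_eq_adjoint, eq_comm, ContinuousLinearMap.eq_adjoint_iff]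
  intro ψ χ
  rw [lp.inner_eq_tsum, lp.inner_eq_tsum]
  have e1 : (fun f : ℕ → Fin n => inner ℂ (matUnit k j i ψ f) (χ f)) =
      Set.indicator {f : ℕ → Fin n | f k = j}
        fun f => inner ℂ (ψ (Function.update f k i)) (χ f) := by
    funext f
    by_cases h : f k = j <;> simp [matUnit_apply, h]
  have e2 : (fun f : ℕ → Fin n => inner ℂ (ψ f) (matUnit k i j χ f)) =
      Set.indicator {f : ℕ → Fin n | f k = i}
        fun f => inner ℂ (ψ f) (χ (Function.update f k j)) := by
    funext f
    by_cases h : f k = i <;> simp [matUnit_apply, h]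
  rw [e1, e2, ← tsum_subtype, ← tsum_subtype]
  refine ((updateEquiv k i j).tsum_eq _).symm.trans (tsum_congr fun f => ?_)
  simp [updateEquiv, ← f.2]

/-- The unital `*`-homomorphism `a ↦ 1 ⊗ ⋯ ⊗ 1 ⊗ a ⊗ 1 ⊗ ⋯` that lets a matrix act on the
tensor factor number `k`. -/
def site {n : ℕ} (k : ℕ) :
    Matrix (Fin n) (Fin n) ℂ →⋆ₐ[ℂ] (ConfigSpace n →L[ℂ] ConfigSpace n) where
  toFun a := ∑ i, ∑ j, a i j • matUnit k i j
  map_one' := by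
    simp [Matrix.one_apply, sum_matUnit]
  map_mul' a b := by
    have h : ∀ i j : Fin n, (a i j • matUnit k i j) * (∑ l, ∑ m, b l m • matUnit k l m) =
        ∑ m, (a i j * b j m) • matUnit k i m := fun i j => by
      simp only [Finset.mul_sum, smul_mul_smul_comm, matUnit_mul, smul_ite, smul_zero]
      rw [Finset.sum_comm]
      simp
    simp only [Finset.sum_mul, h, Matrix.mul_apply, Finset.sum_smul]
    exact Finset.sum_congr rfl fun i _ => Finset.sum_comm
  map_zero' := by simp
  map_add' a b := by simp [add_smul, Finset.sum_add_distrib]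
  commutes' c := by
    simp only [Matrix.algebraMap_matrix_apply, Algebra.algebraMap_self, RingHom.id_apply, ite_smul,
      zero_smul, Finset.sum_ite_eq, Finset.mem_univ, if_true]
    rw [← Finset.smul_sum, sum_matUnit, Algebra.algebraMap_eq_smul_one]
  map_star' a := by
    simp only [star_sum, star_smul, star_matUnit, Matrix.star_apply]
    exact Finset.sum_comm

theorem site_apply {n : ℕ} (k : ℕ) (a : Matrix (Fin n) (Fin n) ℂ) (ψ : ConfigSpace n)
    (f : ℕ → Fin n) : site k a ψ f = ∑ j, a (f k) j * ψ (Function.update f k j) := by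
  change (∑ i, ∑ j, a i j • matUnit k i j) ψ f = _
  rw [sum_apply, lp.coeFn_sum, Finset.sum_apply, Finset.sum_eq_single (f k)]
  · rw [sum_apply, lp.coeFn_sum, Finset.sum_apply]
    simp [matUnit_apply]
  · intro i _ hi
    rw [sum_apply, lp.coeFn_sum, Finset.sum_apply]
    simp [matUnit_apply, Ne.symm hi]
  · simp

/-- The infinite tensor product `⊗_{k=0}^∞ A` as a C*-algebra, for a unital `*`-algebra `A` of
complex `n × n` matrices: the norm closure of the `*`-algebra generated by the copies of `A`
acting on the single tensor factors. The operators on the first `m` factors form a copy of the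
finite-dimensional C*-algebra `A^{⊗ m}`, embedded in that of `A^{⊗ (m + 1)}` by `x ↦ x ⊗ 1`,
so the closure of their union is the C*-inductive limit of the `A^{⊗ m}`. -/
def infTensor {n : ℕ} (A : StarSubalgebra ℂ (Matrix (Fin n) (Fin n) ℂ)) :
    StarSubalgebra ℂ (ConfigSpace n →L[ℂ] ConfigSpace n) :=
  (StarAlgebra.adjoin ℂ {T | ∃ k : ℕ, ∃ a ∈ A, T = site k a}).topologicalClosure

theorem site_mem {n : ℕ} (A : StarSubalgebra ℂ (Matrix (Fin n) (Fin n) ℂ)) (k : ℕ) (a : A) :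
    site k (a : Matrix (Fin n) (Fin n) ℂ) ∈ infTensor A :=
  StarSubalgebra.le_topologicalClosure _ (StarAlgebra.subset_adjoin ℂ _ ⟨k, a, a.2, rfl⟩)

/-- The elementary tensor `a₀ ⊗ a₁ ⊗ ⋯ ⊗ a_{m-1} ⊗ 1 ⊗ 1 ⊗ ⋯`. -/
def elemTensor {n : ℕ} (A : StarSubalgebra ℂ (Matrix (Fin n) (Fin n) ℂ)) {m : ℕ}
    (a : Fin m → A) : infTensor A :=
  (List.ofFn fun k : Fin m =>
    (⟨site k (a k : Matrix (Fin n) (Fin n) ℂ), site_mem A k (a k)⟩ : infTensor A)).prod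

/-- The unitary on `ConfigSpace n` that permutes the tensor factors, moving factor `k` to
position `σ k`. -/
def permUnitary {n : ℕ} (σ : Equiv.Perm ℕ) : ConfigSpace n ≃ₗᵢ[ℂ] ConfigSpace n where
  toFun ψ := ⟨fun f => ψ (f ∘ σ), memℓp_of_summable
    ((summable_norm_sq ψ).comp_injective (σ.surjective.injective_comp_right))⟩
  invFun ψ := ⟨fun f => ψ (f ∘ σ.symm), memℓp_of_summable
    ((summable_norm_sq ψ).comp_injective (σ.symm.surjective.injective_comp_right))⟩
  map_add' _ _ := rfl
  map_smul' _ _ := rfl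
  left_inv ψ := by ext f; simp [Function.comp_assoc]
  right_inv ψ := by ext f; simp [Function.comp_assoc]
  norm_map' ψ := by
    refine (sq_eq_sq₀ (norm_nonneg _) (norm_nonneg _)).1 ?_
    rw [norm_sq_eq, norm_sq_eq]
    exact (σ.symm.arrowCongr (Equiv.refl (Fin n))).tsum_eq fun f => ‖ψ f‖ ^ 2

theorem permUnitary_apply {n : ℕ} (σ : Equiv.Perm ℕ) (ψ : ConfigSpace n) (f : ℕ → Fin n) :
    permUnitary σ ψ f = ψ (f ∘ σ) := rfl

/-- Conjugation `T ↦ U_σ T U_σ*` by the permutation unitary. -/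
def permConj {n : ℕ} (σ : Equiv.Perm ℕ) :
    (ConfigSpace n →L[ℂ] ConfigSpace n) ≃⋆ₐ[ℂ] (ConfigSpace n →L[ℂ] ConfigSpace n) :=
  (permUnitary σ).conjStarAlgEquiv

theorem permConj_site {n : ℕ} (σ : Equiv.Perm ℕ) (k : ℕ) (a : Matrix (Fin n) (Fin n) ℂ) :
    permConj σ (site k a) = site (σ k) a := by
  ext ψ f
  have h : permConj σ (site k a) ψ f = site k a ((permUnitary σ).symm ψ) (f ∘ σ) := rfl
  rw [h, site_apply, site_apply]
  refine Finset.sum_congr rfl fun j _ => ?_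
  have h' : Function.update (f ∘ σ) k j = Function.update f (σ k) j ∘ σ := by
    rw [Function.update_comp_equiv]
    simp
  change a (f (σ k)) j * ψ (Function.update (f ∘ σ) k j ∘ σ.symm) = _
  rw [h', Function.comp_assoc]
  simp

theorem permConj_mem {n : ℕ} (A : StarSubalgebra ℂ (Matrix (Fin n) (Fin n) ℂ))
    (σ : Equiv.Perm ℕ) (T : infTensor A) :
    permConj σ (T : ConfigSpace n →L[ℂ] ConfigSpace n) ∈ infTensor A := by
  have hc : Continuous (permConj (n := n) σ) := by
    change Continuous fun T : ConfigSpace n →L[ℂ] ConfigSpace n =>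
      (permUnitary (n := n) σ).toContinuousLinearEquiv.toContinuousLinearMap ∘L T ∘L
        (permUnitary (n := n) σ).symm.toContinuousLinearEquiv.toContinuousLinearMap
    fun_prop
  have hle : infTensor A ≤
      (infTensor A).comap (permConj (n := n) σ).toStarAlgHom := by
    refine StarSubalgebra.topologicalClosure_minimal (StarAlgebra.adjoin_le ?_) ?_
    · rintro _ ⟨k, a, ha, rfl⟩
      change permConj σ (site k a) ∈ infTensor A
      rw [permConj_site]
      exact site_mem A (σ k) ⟨a, ha⟩
    · exact (StarSubalgebra.isClosed_topologicalClosure _).preimage hc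
  exact hle T.2

/-- The action of the permutation `σ` on `⊗^∞ A`, moving the tensor factor `k` to
position `σ k`. -/
def permAct {n : ℕ} (A : StarSubalgebra ℂ (Matrix (Fin n) (Fin n) ℂ)) (σ : Equiv.Perm ℕ) :
    infTensor A →⋆ₐ[ℂ] infTensor A :=
  StarAlgHom.codRestrict
    ((permConj σ).toStarAlgHom.comp (infTensor A).subtype)
    (infTensor A) (permConj_mem A σ)

/-- A state: a linear functional that is positive and takes the value `1` at the unit. -/
def IsState {B : Type*} [Ring B] [StarRing B] [Algebra ℂ B] (φ : B →ₗ[ℂ] ℂ) : Prop :=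
  φ 1 = 1 ∧ ∀ x : B, 0 ≤ φ (star x * x)

/-- The states on `⊗^∞ A` that are invariant under all permutations of finitely many
tensor factors. -/
def symmetricStates {n : ℕ} (A : StarSubalgebra ℂ (Matrix (Fin n) (Fin n) ℂ)) :
    Set (infTensor A →ₗ[ℂ] ℂ) :=
  {φ | IsState φ ∧
    ∀ σ : Equiv.Perm ℕ, {k | σ k ≠ k}.Finite → ∀ x, φ (permAct A σ x) = φ x}

/-- `φ` is an infinite product state `ρ ⊗ ρ ⊗ ⋯`:
a state with `φ (a₀ ⊗ ⋯ ⊗ a_{m-1} ⊗ 1 ⊗ ⋯) = ρ a₀ ⋯ ρ a_{m-1}`. -/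
def IsProductState {n : ℕ} {A : StarSubalgebra ℂ (Matrix (Fin n) (Fin n) ℂ)}
    (ρ : A →ₗ[ℂ] ℂ) (φ : infTensor A →ₗ[ℂ] ℂ) : Prop :=
  IsState φ ∧ ∀ (m : ℕ) (a : Fin m → A), φ (elemTensor A a) = ∏ k, ρ (a k)

end InfTensor

end

noncomputable section

namespace InfTensor

open scoped Pointwise

/-! ### States on `*`-algebras: Cauchy–Schwarz, boundedness, limits. -/

section States

variable {B : Type*} [Ring B] [StarRing B] [Algebra ℂ B] [StarModule ℂ B] {φ : B →ₗ[ℂ] ℂ}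

/-! Uniqueness: states are continuous and elementary tensors span a dense subspace, so a state is
determined by its values on them (`IsState.ext_factorProd`).

Existence: a state `ρ` on `A` has Kraus operators with `∑ K* a K = ρ(a) 1` (`exists_kraus`). Letting
them act at one further site extends a state with product values on the first `m` sites to `m + 1`
sites (`exists_state_range`). An ultrafilter limit over `m` is the product state.

Extremality: if `φ` is the product state and `φ = t φ₁ + u φ₂`, then `φ₁ ≤ t⁻¹ φ` on positive
elements. Let `ρ(b) = 0`. By symmetry `φ₁` takes one value `c` on `y b_l` for all sites `l` off the
support of `y`, so `φ₁` is `N c` on `y` times a sum of `N` copies of `b`. Cauchy–Schwarz bounds `N²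
|c|²` by a multiple of `φ(|∑ b_l|²) = N ρ(b* b)`, which forces `c = 0`. Centring one factor at a
time then gives `φ₁ = φ` (`eq_of_le_smul_isProductState`). -/

theorem IsState.map_star (hφ : IsState φ) (x : B) : φ (star x) = star (φ x) := by
  -- Polarisation: reality of `φ` on the squares of `x`, `1 + x` and `1 + i x` fixes the imaginary
  -- and real parts of `φ (star x)`.
  have h0 := (Complex.nonneg_iff.1 (hφ.2 x)).2
  have h1 := (Complex.nonneg_iff.1 (hφ.2 (1 + x))).2
  have h2 := (Complex.nonneg_iff.1 (hφ.2 (1 + Complex.I • x))).2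
  simp only [star_add, star_one, star_smul, mul_add, add_mul, one_mul, mul_one, map_add, hφ.1,
    map_smul, smul_mul_smul_comm, Complex.add_im, smul_eq_mul, Complex.mul_im] at h1 h2
  simp at h1 h2
  apply Complex.ext <;> simp <;> linarith

/-- Cauchy–Schwarz inequality for states. -/
theorem IsState.norm_map_star_mul_sq_le (hφ : IsState φ) (x y : B) :
    ‖φ (star x * y)‖ ^ 2 ≤ (φ (star x * x)).re * (φ (star y * y)).re := by
  let c : PreInnerProductSpace.Core ℂ B :=
    { inner := fun x y => φ (star x * y)
      conj_inner_symm := fun x y => by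
        have h := hφ.map_star (star y * x)
        simpa using h.symm
      re_inner_nonneg := fun x => (Complex.nonneg_iff.1 (hφ.2 x)).1
      add_left := fun x y z => by simp [add_mul]
      smul_left := fun x y r => by simp }
  have h := @InnerProductSpace.Core.inner_mul_inner_self_le ℂ B _ _ _ c x y
  have h' : ‖φ (star y * x)‖ = ‖φ (star x * y)‖ := by
    have := hφ.map_star (star x * y)
    rw [star_mul, star_star] at this
    rw [this, norm_star]
  change ‖φ (star x * y)‖ * ‖φ (star y * x)‖ ≤ (φ (star x * x)).re * (φ (star y * y)).re at h
  rwa [h', ← sq] at h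

end States

/-- In the spectral order `‖x‖² - x* x` is positive, hence of the form `y* y`, so `φ(x* x) ≤ ‖x‖²`;
Cauchy–Schwarz against `1` finishes. -/
theorem IsState.norm_le {B : Type*} [CStarAlgebra B] {φ : B →ₗ[ℂ] ℂ} (hφ : IsState φ) (x : B) :
    ‖φ x‖ ≤ ‖x‖ := by
  let _ := CStarAlgebra.spectralOrder B
  have := CStarAlgebra.spectralOrderedRing B
  have h1 := hφ.norm_map_star_mul_sq_le 1 x
  obtain ⟨y, hy⟩ := CStarAlgebra.nonneg_iff_eq_star_mul_self.1
    (sub_nonneg.2 (CStarAlgebra.star_mul_le_algebraMap_norm_sq (a := x)))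
  have h2 := (Complex.nonneg_iff.1 (hφ.2 y)).1
  have h3 : algebraMap ℝ B (‖x‖ ^ 2) = ((‖x‖ ^ 2 : ℝ) : ℂ) • (1 : B) := by
    rw [Algebra.algebraMap_eq_smul_one, Complex.coe_smul]
  rw [← hy, h3, map_sub, map_smul, hφ.1] at h2
  simp only [star_one, one_mul, hφ.1, Complex.one_re] at h1
  simp only [smul_eq_mul, mul_one, Complex.sub_re, Complex.ofReal_re] at h2
  exact le_of_sq_le_sq (by linarith) (norm_nonneg _)

theorem IsState.continuous {B : Type*} [CStarAlgebra B] {φ : B →ₗ[ℂ] ℂ} (hφ : IsState φ) :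
    Continuous φ :=
  AddMonoidHomClass.continuous_of_bound φ 1 fun x => by simpa using hφ.norm_le x

/-- A pointwise limit of states along an ultrafilter is a state; on a C*-algebra it exists. -/
theorem exists_state_tendsto {B : Type*} [CStarAlgebra B] {ι : Type*} (U : Ultrafilter ι)
    (φ : ι → B →ₗ[ℂ] ℂ) (hφ : ∀ i, IsState (φ i)) :
    ∃ ψ : B →ₗ[ℂ] ℂ, IsState ψ ∧ ∀ x, Filter.Tendsto (fun i => φ i x) U (nhds (ψ x)) := by
  have h : ∀ x, ∃ z, Filter.Tendsto (fun i => φ i x) U (nhds z) := fun x => by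
    obtain ⟨z, _, hz⟩ := (isCompact_closedBall (0 : ℂ) ‖x‖).ultrafilter_le_nhds
      (U.map fun i => φ i x) (by
        simp only [Filter.le_principal_iff, Ultrafilter.mem_coe, Ultrafilter.mem_map]
        exact Filter.Eventually.of_forall fun i => by simpa using (hφ i).norm_le x)
    exact ⟨z, hz⟩
  choose L hL using h
  refine ⟨{ toFun := L, map_add' := fun x y => ?_, map_smul' := fun c x => ?_ }, ⟨?_, fun x => ?_⟩,
    hL⟩
  · refine tendsto_nhds_unique (hL (x + y)) ?_
    simpa using (hL x).add (hL y)
  · refine tendsto_nhds_unique (hL (c • x)) ?_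
    simpa using (hL x).const_mul c
  · refine tendsto_nhds_unique (hL 1) ?_
    simp [(hφ _).1]
  · exact ge_of_tendsto' (hL (star x * x)) fun i => (hφ i).2 x

/-! ### Density matrices and Kraus operators. -/

/-- A state on a `*`-algebra of matrices has a Kraus decomposition. -/
theorem exists_kraus {n : ℕ} (A : StarSubalgebra ℂ (Matrix (Fin n) (Fin n) ℂ))
    (ρ : A →ₗ[ℂ] ℂ) (hρ : IsState ρ) :
    ∃ K : Fin n × Fin n → Matrix (Fin n) (Fin n) ℂ,
      ∀ a : A, ∑ p, star (K p) * (a : Matrix (Fin n) (Fin n) ℂ) * K p = ρ a • 1 := by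
  let M := Matrix (Fin n) (Fin n) ℂ
  have _ : FiniteDimensional ℂ A :=
    inferInstanceAs (FiniteDimensional ℂ (Subalgebra.toSubmodule A.toSubalgebra))
  have hcl : IsClosed (A : Set M) :=
    (Subalgebra.toSubmodule A.toSubalgebra).closed_of_finiteDimensional
  -- The trace pairing on `A` is nondegenerate, since `tr (d d*) = 0` forces `d = 0`. Hence `ρ = tr
  -- (d ·)` with a density matrix `d` in `A` itself.
  let T : A →ₗ[ℂ] Module.Dual ℂ A :=
    LinearMap.mk₂ ℂ (fun d a => Matrix.trace ((d : M) * (a : M)))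
      (fun x y z => by simp [add_mul]) (fun c x z => by simp)
      (fun x y z => by simp [mul_add]) (fun c x z => by simp)
  have hT : ∀ d a : A, T d a = Matrix.trace ((d : M) * (a : M)) := fun _ _ => rfl
  have hinj : Function.Injective T := by
    rw [← LinearMap.ker_eq_bot, LinearMap.ker_eq_bot']
    intro d hd
    have h := hT d (star d)
    rw [hd] at h
    have h2 : ((d : M) * (d : M).conjTranspose).trace = 0 := h.symm
    exact Subtype.ext (Matrix.trace_mul_conjTranspose_self_eq_zero_iff.1 h2)
  have hsurj : Function.Surjective T :=
    (LinearMap.injective_iff_surjective_of_finrank_eq_finrank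
      Subspace.dual_finrank_eq.symm).1 hinj
  obtain ⟨d, hd⟩ := hsurj ρ
  have hd' : ∀ a : A, ρ a = Matrix.trace ((d : M) * (a : M)) := fun a => by rw [← hd, hT]
  have hsa : IsSelfAdjoint (d : M) := by
    have : T (star d) = T d := by
      ext a
      rw [hT, hT, ← hd', ← star_star a, hρ.map_star, hd', ← Matrix.trace_conjTranspose,
        Matrix.conjTranspose_mul, Matrix.trace_mul_comm]
      simp [Matrix.star_eq_conjTranspose]
    exact congrArg Subtype.val (hinj this)
  -- `f` and `g` are the square roots of the negative and positive parts. Since `f(d)` lies in `A`,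
  -- positivity of `ρ` can be tested on it; as `t f(t)² = -(f(t)²)²`, this kills the negative part
  -- of `d`, leaving `d = g(d)²`.
  let f : ℝ → ℝ := fun t => √(-t)
  let g : ℝ → ℝ := fun t => √t
  have hc : ∀ h : ℝ → ℝ, ContinuousOn h (spectrum ℝ (d : M)) := fun h =>
    (Matrix.finite_real_spectrum (A := (d : M))).continuousOn h
  have hx : cfc f (d : M) ∈ A := cfc_mem (hs := hcl) f d.2
  have hy : cfc (fun t => f t * f t) (d : M) = 0 := by
    have h1 := hρ.2 ⟨cfc f (d : M), hx⟩
    have h2 : (d : M) * (star (cfc f (d : M)) * cfc f (d : M)) =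
        -(star (cfc (fun t => f t * f t) (d : M)) * cfc (fun t => f t * f t) (d : M)) := by
      rw [(cfc_predicate f (d : M) : IsSelfAdjoint _).star_eq,
        (cfc_predicate (fun t => f t * f t) (d : M) : IsSelfAdjoint _).star_eq,
        ← cfc_mul _ _ _ (hc _) (hc _), ← cfc_mul _ _ _ (hc _) (hc _), ← cfc_neg]
      nth_rw 1 [← cfc_id' ℝ (d : M) hsa]
      rw [← cfc_mul _ _ _ (hc _) (hc _)]
      congr 1
      funext t
      rcases le_total 0 t with h | h
      · simp [f, Real.sqrt_eq_zero_of_nonpos (neg_nonpos.2 h)]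
      · simp only [f, Real.mul_self_sqrt (neg_nonneg.2 h)]
        ring
    rw [hd'] at h1
    change 0 ≤ Matrix.trace ((d : M) * (star (cfc f (d : M)) * cfc f (d : M))) at h1
    rw [h2, Matrix.trace_neg] at h1
    have h3 := (Matrix.posSemidef_conjTranspose_mul_self
      (cfc (fun t => f t * f t) (d : M))).trace_nonneg
    exact Matrix.trace_conjTranspose_mul_self_eq_zero_iff.1
      (le_antisymm (neg_nonneg.1 h1) h3)
  have hk : (d : M) = cfc g (d : M) * cfc g (d : M) := by
    rw [← cfc_mul _ _ _ (hc _) (hc _), ← sub_zero (cfc (fun t => g t * g t) (d : M)), ← hy,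
      ← cfc_sub _ _ _ (hc _) (hc _)]
    nth_rw 1 [← cfc_id' ℝ (d : M) hsa]
    congr 1
    funext t
    rcases le_total 0 t with h | h
    · simp [f, g, Real.sqrt_eq_zero_of_nonpos (neg_nonpos.2 h), Real.mul_self_sqrt h]
    · simp [f, g, Real.sqrt_eq_zero_of_nonpos h, Real.mul_self_sqrt (neg_nonneg.2 h)]
  have hks : star (cfc g (d : M)) = cfc g (d : M) :=
    (cfc_predicate g (d : M) : IsSelfAdjoint _).star_eq
  generalize cfc g (d : M) = k at hk hks
  -- With `d = k²`, the sum of `E_ji (k a k) E_ij` over all `i, j` is `tr (k a k) 1 = ρ(a) 1`.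
  refine ⟨fun p => k * Matrix.single p.1 p.2 1, fun a => ?_⟩
  have h1 : ∀ p : Fin n × Fin n, star (k * Matrix.single p.1 p.2 (1 : ℂ)) * (a : M) *
      (k * Matrix.single p.1 p.2 1) =
        Matrix.single p.2 p.2 ((k * (a : M) * k) p.1 p.1) := fun p => by
    have : star (Matrix.single p.1 p.2 (1 : ℂ)) = Matrix.single p.2 p.1 1 := by
      simp [Matrix.star_eq_conjTranspose]
    rw [star_mul, hks, this]
    calc _ = Matrix.single p.2 p.1 1 * (k * (a : M) * k) * Matrix.single p.1 p.2 1 := by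
          simp only [mul_assoc]
      _ = _ := by rw [Matrix.single_mul_mul_single]; simp
  rw [Finset.sum_congr rfl fun p _ => h1 p, Fintype.sum_prod_type]
  have h2 : ρ a = Matrix.trace (k * (a : M) * k) := by
    rw [hd', hk, Matrix.trace_mul_comm (k * (a : M)), mul_assoc]
  rw [Finset.sum_comm, h2, Matrix.trace, ← Matrix.sum_single_one, Finset.smul_sum]
  refine Finset.sum_congr rfl fun j _ => ?_
  rw [Finset.sum_smul]
  refine Finset.sum_congr rfl fun i _ => ?_
  simp [Matrix.diag]

/-! ### Elementary tensors indexed by finite sets of sites. -/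

theorem commute_site {n : ℕ} {k l : ℕ} (h : k ≠ l) (a b : Matrix (Fin n) (Fin n) ℂ) :
    Commute (site k a) (site l b) := by
  ext ψ f
  change site k a (site l b ψ) f = site l b (site k a ψ) f
  simp only [site_apply, Finset.mul_sum, Function.update_of_ne h, Function.update_of_ne h.symm]
  rw [Finset.sum_comm]
  refine Finset.sum_congr rfl fun i _ => Finset.sum_congr rfl fun j _ => ?_
  rw [Function.update_comm h]
  ring

variable {n : ℕ} {A : StarSubalgebra ℂ (Matrix (Fin n) (Fin n) ℂ)}

theorem isClosed_infTensor (A : StarSubalgebra ℂ (Matrix (Fin n) (Fin n) ℂ)) :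
    IsClosed (infTensor A : Set (ConfigSpace n →L[ℂ] ConfigSpace n)) :=
  StarSubalgebra.isClosed_topologicalClosure _

/-- The embedding of `A` into `⊗^∞ A` as the tensor factor number `k`. -/
def factor (A : StarSubalgebra ℂ (Matrix (Fin n) (Fin n) ℂ)) (k : ℕ) : A →⋆ₐ[ℂ] infTensor A :=
  StarAlgHom.codRestrict ((site k).comp A.subtype) (infTensor A) (site_mem A k)

@[simp]
theorem coe_factor (k : ℕ) (a : A) :
    (factor A k a : ConfigSpace n →L[ℂ] ConfigSpace n) = site k (a : Matrix (Fin n) (Fin n) ℂ) :=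
  rfl

theorem commute_factor {k l : ℕ} (h : k ≠ l) (a b : A) : Commute (factor A k a) (factor A l b) :=
  Subtype.ext (commute_site h (a : Matrix (Fin n) (Fin n) ℂ) b)

theorem permAct_factor (σ : Equiv.Perm ℕ) (k : ℕ) (a : A) :
    permAct A σ (factor A k a) = factor A (σ k) a :=
  Subtype.ext (permConj_site σ k (a : Matrix (Fin n) (Fin n) ℂ))

theorem pairwise_commute_factor (s : Set ℕ) (a : ℕ → A) :
    s.Pairwise (Function.onFun Commute fun k => factor A k (a k)) :=
  fun _ _ _ _ h => commute_factor h _ _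

/-- The product over `k ∈ s` of the elements `a k` acting on the tensor factor number `k`. -/
def factorProd (s : Finset ℕ) (a : ℕ → A) : infTensor A :=
  s.noncommProd (fun k => factor A k (a k)) (pairwise_commute_factor _ a)

@[simp]
theorem factorProd_empty (a : ℕ → A) : factorProd ∅ a = 1 := rfl

theorem factorProd_insert {s : Finset ℕ} {k : ℕ} (hk : k ∉ s) (a : ℕ → A) :
    factorProd (insert k s) a = factorProd s a * factor A k (a k) :=
  Finset.noncommProd_insert_of_notMem' _ _ _ _ hk

theorem factorProd_congr {s : Finset ℕ} {a b : ℕ → A} (h : ∀ k ∈ s, a k = b k) :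
    factorProd s a = factorProd s b :=
  Finset.noncommProd_congr rfl (fun k hk => by rw [h k hk]) _

/-- Here `b` is an arbitrary matrix, because the Kraus operators need not lie in `A`. -/
theorem commute_site_factorProd {k : ℕ} {s : Finset ℕ} (hk : k ∉ s)
    (b : Matrix (Fin n) (Fin n) ℂ) (a : ℕ → A) :
    Commute (site k b) (factorProd s a : ConfigSpace n →L[ℂ] ConfigSpace n) := by
  induction s using Finset.induction_on with
  | empty => exact Commute.one_right _
  | insert l s hl ih =>
    rw [factorProd_insert hl]
    rw [Finset.mem_insert, not_or] at hk
    exact (ih hk.2).mul_right (commute_site hk.1 _ _)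

theorem commute_factor_factorProd {k : ℕ} {s : Finset ℕ} (hk : k ∉ s) (b : A) (a : ℕ → A) :
    Commute (factor A k b) (factorProd s a) :=
  Subtype.ext (commute_site_factorProd hk _ a)

theorem factorProd_mul (s : Finset ℕ) (a b : ℕ → A) :
    factorProd s (a * b) = factorProd s a * factorProd s b := by
  induction s using Finset.induction_on with
  | empty => simp
  | insert k s hk ih =>
    simp only [factorProd_insert hk, ih, Pi.mul_apply, map_mul]
    have h := (commute_factor_factorProd hk (a k) b).eq
    calc _ = factorProd s a * (factorProd s b * factor A k (a k)) * factor A k (b k) := by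
          simp only [mul_assoc]
      _ = _ := by rw [← h]; simp only [mul_assoc]

theorem factorProd_star (s : Finset ℕ) (a : ℕ → A) :
    factorProd s (star a) = star (factorProd s a) := by
  induction s using Finset.induction_on with
  | empty => simp
  | insert k s hk ih =>
    rw [factorProd_insert hk, factorProd_insert hk, star_mul, ← ih, Pi.star_apply, ← map_star]
    exact (commute_factor_factorProd hk _ _).eq.symm

theorem factorProd_subset {s t : Finset ℕ} (h : s ⊆ t) {a : ℕ → A} (ha : ∀ k ∉ s, a k = 1) :
    factorProd t a = factorProd s a := by
  rw [← Finset.union_sdiff_of_subset h]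
  have hd : Disjoint s (t \ s) := Finset.disjoint_sdiff
  generalize t \ s = u at hd
  induction u using Finset.induction_on with
  | empty => simp
  | insert k u hk ih =>
    rw [Finset.disjoint_insert_right] at hd
    rw [Finset.union_insert, factorProd_insert (by simp [hd.1, hk]), ih hd.2, ha k hd.1, map_one,
      mul_one]

theorem factorProd_piecewise {s t : Finset ℕ} (h : s ⊆ t) (a : ℕ → A) :
    factorProd t (s.piecewise a 1) = factorProd s a := by
  rw [factorProd_subset h fun k hk => by simp [hk]]
  exact factorProd_congr fun k hk => by simp [hk]

theorem permAct_factorProd_of_fixed {σ : Equiv.Perm ℕ} {s : Finset ℕ} (h : ∀ k ∈ s, σ k = k)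
    (a : ℕ → A) : permAct A σ (factorProd s a) = factorProd s a := by
  induction s using Finset.induction_on with
  | empty => simp
  | insert k s hk ih =>
    rw [factorProd_insert hk, map_mul, ih fun l hl => h l (Finset.mem_insert_of_mem hl),
      permAct_factor, h k (Finset.mem_insert_self k s)]

theorem permAct_factorProd (σ : Equiv.Perm ℕ) (s : Finset ℕ) (a : ℕ → A) :
    permAct A σ (factorProd s a) = factorProd (s.map σ.toEmbedding) (a ∘ σ.symm) := by
  induction s using Finset.induction_on with
  | empty => simp
  | insert k s hk ih =>
    rw [factorProd_insert hk, map_mul, ih, permAct_factor, Finset.map_insert, factorProd_insert]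
    · simp
    · simpa using hk

theorem elemTensor_eq {m : ℕ} (a : Fin m → A) :
    elemTensor A a =
      factorProd (Finset.range m) (fun k => if h : k < m then a ⟨k, h⟩ else 1) := by
  induction m with
  | zero => simp [elemTensor]
  | succ m ih =>
    have h : elemTensor A a = elemTensor A (fun k : Fin m => a k.castSucc) *
        factor A m (a (Fin.last m)) := by
      unfold elemTensor
      rw [List.ofFn_succ', List.concat_eq_append, List.prod_append, List.prod_singleton]
      rfl
    rw [h, ih, Finset.range_add_one, factorProd_insert Finset.notMem_range_self]
    congr 1
    · refine factorProd_congr fun k hk => ?_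
      have hk := Finset.mem_range.1 hk
      simp [hk, hk.trans (Nat.lt_succ_self m)]
    · simp [Fin.last]

/-- The linear span of the elementary tensors is dense in `⊗^∞ A`. -/
theorem dense_span_factorProd (A : StarSubalgebra ℂ (Matrix (Fin n) (Fin n) ℂ)) :
    Dense (Submodule.span ℂ {x : infTensor A | ∃ s a, x = factorProd s a} : Set (infTensor A)) := by
  set S : Set (infTensor A) := {x | ∃ s a, x = factorProd s a} with hS
  have hmul : ∀ x ∈ Submodule.span ℂ S, ∀ y ∈ Submodule.span ℂ S,
      x * y ∈ Submodule.span ℂ S := by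
    intro x hx y hy
    have h : S * S ⊆ S := by
      rintro _ ⟨_, ⟨s, a, rfl⟩, _, ⟨t, b, rfl⟩, rfl⟩
      -- Padding both families with `1` puts them on the common support `s ∪ t`, where products
      -- multiply site by site.
      refine ⟨s ∪ t, s.piecewise a 1 * t.piecewise b 1, ?_⟩
      rw [factorProd_mul, factorProd_piecewise Finset.subset_union_left,
        factorProd_piecewise Finset.subset_union_right]
    refine Submodule.span_mono h ?_
    rw [← Submodule.span_mul_span]
    exact Submodule.mul_mem_mul hx hy
  have hstar : ∀ x ∈ Submodule.span ℂ S, star x ∈ Submodule.span ℂ S := by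
    intro x hx
    induction hx using Submodule.span_induction with
    | mem x hx =>
      obtain ⟨s, a, rfl⟩ := hx
      exact Submodule.subset_span ⟨s, star a, (factorProd_star s a).symm⟩
    | zero => simp
    | add x y _ _ hx hy => rw [star_add]; exact add_mem hx hy
    | smul c x _ hx => rw [star_smul]; exact Submodule.smul_mem _ _ hx
  have hadj : ∀ T ∈ StarAlgebra.adjoin ℂ {T | ∃ k : ℕ, ∃ a ∈ A, T = site k a},
      ∃ x ∈ Submodule.span ℂ S, (x : ConfigSpace n →L[ℂ] ConfigSpace n) = T := by
    intro T hT
    induction hT using StarAlgebra.adjoin_induction with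
    | mem T hT =>
      obtain ⟨k, a, ha, rfl⟩ := hT
      refine ⟨factor A k ⟨a, ha⟩, Submodule.subset_span ⟨{k}, fun _ => ⟨a, ha⟩, ?_⟩, rfl⟩
      simp [factorProd]
    | algebraMap c =>
      exact ⟨algebraMap ℂ _ c, by
        rw [Algebra.algebraMap_eq_smul_one]
        exact Submodule.smul_mem _ _ (Submodule.subset_span ⟨∅, 1, rfl⟩), rfl⟩
    | add _ _ _ _ hx hy =>
      obtain ⟨x, hx, rfl⟩ := hx
      obtain ⟨y, hy, rfl⟩ := hy
      exact ⟨x + y, add_mem hx hy, rfl⟩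
    | mul _ _ _ _ hx hy =>
      obtain ⟨x, hx, rfl⟩ := hx
      obtain ⟨y, hy, rfl⟩ := hy
      exact ⟨x * y, hmul x hx y hy, rfl⟩
    | star _ _ hx =>
      obtain ⟨x, hx, rfl⟩ := hx
      exact ⟨star x, hstar x hx, rfl⟩
  intro x
  rw [Topology.IsInducing.subtypeVal.closure_eq_preimage_closure_image]
  exact closure_mono (fun T hT => hadj T hT) x.2

/-! ### Product states: uniqueness, existence, symmetry. -/

variable {n : ℕ} {A : StarSubalgebra ℂ (Matrix (Fin n) (Fin n) ℂ)} {ρ : A →ₗ[ℂ] ℂ}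
  {φ ψ : infTensor A →ₗ[ℂ] ℂ}

theorem IsState.continuous_infTensor (hφ : IsState φ) : Continuous φ :=
  -- Closedness supplies the C*-algebra structure on `infTensor A`.
  haveI := isClosed_infTensor A
  IsState.continuous hφ

theorem IsState.ext_factorProd (hφ : IsState φ) (hψ : IsState ψ)
    (h : ∀ s a, φ (factorProd s a) = ψ (factorProd s a)) : φ = ψ := by
  refine DFunLike.coe_injective (Continuous.ext_on (dense_span_factorProd A)
    hφ.continuous_infTensor hψ.continuous_infTensor ?_)
  refine LinearMap.eqOn_span ?_
  rintro _ ⟨s, a, rfl⟩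
  exact h s a

theorem map_factorProd_of_range (hρ : ρ 1 = 1) {m : ℕ}
    (h : ∀ a, φ (factorProd (Finset.range m) a) = ∏ k ∈ Finset.range m, ρ (a k))
    {s : Finset ℕ} (hs : s ⊆ Finset.range m) (a : ℕ → A) :
    φ (factorProd s a) = ∏ k ∈ s, ρ (a k) := by
  rw [← factorProd_piecewise hs, h, ← Finset.prod_subset hs fun k _ hk => by simp [hk, hρ]]
  exact Finset.prod_congr rfl fun k hk => by simp [hk]

/-- Arbitrary finite sets of sites replace initial segments, so that later inductions may insert any
site. -/
theorem isProductState_iff (hρ : ρ 1 = 1) :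
    IsProductState ρ φ ↔ IsState φ ∧ ∀ s a, φ (factorProd s a) = ∏ k ∈ s, ρ (a k) := by
  refine and_congr_right fun _ => ⟨fun h s a => ?_, fun h m a => ?_⟩
  · obtain ⟨m, hm⟩ := s.exists_nat_subset_range
    refine map_factorProd_of_range hρ (fun a => ?_) hm a
    have h' := h m fun k => a k
    rw [elemTensor_eq, Fin.prod_univ_eq_prod_range (fun k => ρ (a k))] at h'
    rw [← h']
    exact congrArg φ (factorProd_congr fun k hk => by simp [Finset.mem_range.1 hk])
  · rw [elemTensor_eq, h, Finset.prod_range]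
    simp

/-- The Kraus operators at site `m` commute with the factors at earlier sites and turn `a m` into
the scalar `ρ (a m)`. Working with states on all bounded operators leaves room for Kraus operators
outside `A`. -/
theorem exists_state_range (hρ : IsState ρ) (m : ℕ) :
    ∃ ω : (ConfigSpace n →L[ℂ] ConfigSpace n) →ₗ[ℂ] ℂ, IsState ω ∧ ∀ a : ℕ → A,
      ω (factorProd (Finset.range m) a) = ∏ k ∈ Finset.range m, ρ (a k) := by
  induction m with
  | zero =>
    -- For `n = 0` one has `1 = 0` in `A`, which then carries no state. For `m = 0` any state
    -- serves; a basis vector state is taken.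
    have hn : n ≠ 0 := by
      rintro rfl
      have h : (1 : A) = 0 := Subtype.ext (Subsingleton.elim _ _)
      have h1 := hρ.1
      rw [h, map_zero] at h1
      exact zero_ne_one h1
    have := NeZero.mk hn
    classical
    let e : ConfigSpace n := lp.single 2 (fun _ => 0) 1
    have he : ‖e‖ = 1 := by simp [e, lp.norm_single]
    have h1 : inner ℂ e e = 1 := by rw [inner_self_eq_norm_sq_to_K, he]; simp
    refine ⟨{ toFun := fun T => inner ℂ e (T e), map_add' := fun S T => ?_,
              map_smul' := fun c T => ?_ }, ⟨h1, fun T => ?_⟩, fun a => ?_⟩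
    · simp
    · simp
    · change 0 ≤ inner ℂ e ((star T * T) e)
      rw [ContinuousLinearMap.star_eq_adjoint, mul_apply_eq_comp,
        ContinuousLinearMap.adjoint_inner_right, inner_self_eq_norm_sq_to_K]
      simp
    · simpa using h1
  | succ m ih =>
    obtain ⟨ω, hω, h⟩ := ih
    obtain ⟨K, hK⟩ := exists_kraus A ρ hρ
    have hsite : ∀ a : A, ∑ p, star (site m (K p)) * site m (a : Matrix (Fin n) (Fin n) ℂ) *
        site m (K p) = ρ a • 1 := fun a => by
      simp only [← map_star, ← map_mul, ← map_sum, hK a, map_smul, map_one]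
    refine ⟨{ toFun := fun T => ω (∑ p, star (site m (K p)) * T * site m (K p)),
              map_add' := fun S T => ?_, map_smul' := fun c T => ?_ },
      ⟨?_, fun T => ?_⟩, fun a => ?_⟩
    · simp [mul_add, add_mul, Finset.sum_add_distrib]
    · simp [Finset.mul_sum]
    · have h1 := hsite 1
      rw [OneMemClass.coe_one, map_one, hρ.1, one_smul] at h1
      change ω (∑ p, star (site m (K p)) * 1 * site m (K p)) = 1
      rw [h1, hω.1]
    · change 0 ≤ ω (∑ p, star (site m (K p)) * (star T * T) * site m (K p))
      rw [map_sum]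
      refine Finset.sum_nonneg fun p _ => ?_
      have h2 := hω.2 (T * site m (K p))
      simpa only [star_mul, mul_assoc] using h2
    · change ω (∑ p, star (site m (K p)) * (factorProd (Finset.range (m + 1)) a : infTensor A) *
        site m (K p)) = _
      rw [Finset.range_add_one, factorProd_insert Finset.notMem_range_self,
        Finset.prod_insert Finset.notMem_range_self, ← h a, ← smul_eq_mul (ρ (a m)), ← map_smul ω]
      refine congrArg ω ?_
      have h3 := commute_site_factorProd (A := A) (Finset.notMem_range_self (n := m))
      calc _ = (factorProd (Finset.range m) a : ConfigSpace n →L[ℂ] ConfigSpace n) *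
            ∑ p, star (site m (K p)) * site m (a m : Matrix (Fin n) (Fin n) ℂ) *
              site m (K p) := by
            rw [Finset.mul_sum]
            refine Finset.sum_congr rfl fun p _ => ?_
            rw [← map_star, MulMemClass.coe_mul, coe_factor, ← mul_assoc, (h3 _ a).eq]
            simp only [mul_assoc]
        _ = _ := by rw [hsite]; simp

theorem exists_isProductState (hρ : IsState ρ) : ∃ φ, IsProductState ρ φ := by
  have := isClosed_infTensor A
  choose ω hω h using exists_state_range hρ
  let χ : ℕ → infTensor A →ₗ[ℂ] ℂ := fun m =>
    (ω m).comp (infTensor A).subtype.toAlgHom.toLinearMap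
  have hχ : ∀ m, IsState (χ m) := fun m => ⟨(hω m).1, fun x => (hω m).2 x⟩
  obtain ⟨φ, hφ, hlim⟩ := exists_state_tendsto (Filter.hyperfilter ℕ) χ hχ
  refine ⟨φ, (isProductState_iff hρ.1).2 ⟨hφ, fun s a => ?_⟩⟩
  -- On a fixed elementary tensor the values are constant once `m` exceeds its support.
  refine tendsto_nhds_unique (hlim _) (Filter.Tendsto.congr' ?_ tendsto_const_nhds)
  obtain ⟨m, hm⟩ := s.exists_nat_subset_range
  refine Filter.Eventually.filter_mono Nat.hyperfilter_le_atTop ?_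
  filter_upwards [Filter.eventually_ge_atTop m] with i hi
  exact (map_factorProd_of_range (φ := χ i) hρ.1 (h i)
    (hm.trans (Finset.range_subset_range.2 hi)) a).symm

theorem IsProductState.unique (hρ : ρ 1 = 1) (hφ : IsProductState ρ φ)
    (hψ : IsProductState ρ ψ) : φ = ψ :=
  hφ.1.ext_factorProd hψ.1 fun s a => by
    rw [((isProductState_iff hρ).1 hφ).2, ((isProductState_iff hρ).1 hψ).2]

theorem IsProductState.mem_symmetricStates (hρ : ρ 1 = 1) (hφ : IsProductState ρ φ) :
    φ ∈ symmetricStates A := by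
  refine ⟨hφ.1, fun σ _ x => ?_⟩
  have h : IsState (φ.comp (permAct A σ).toAlgHom.toLinearMap) :=
    ⟨by simpa using hφ.1.1, fun x => by
      simpa [map_star] using hφ.1.2 (permAct A σ x)⟩
  refine DFunLike.congr_fun (h.ext_factorProd hφ.1 fun s a => ?_) x
  change φ (permAct A σ (factorProd s a)) = _
  rw [permAct_factorProd, ((isProductState_iff hρ).1 hφ).2, ((isProductState_iff hρ).1 hφ).2]
  simp

/-! ### Extremality. -/

theorem IsProductState.map_factor (hρ : ρ 1 = 1) (hφ : IsProductState ρ φ) (k : ℕ) (a : A) :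
    φ (factor A k a) = ρ a := by
  simpa [factorProd] using ((isProductState_iff hρ).1 hφ).2 {k} fun _ => a

theorem IsProductState.map_factor_mul_factor (hρ : ρ 1 = 1) (hφ : IsProductState ρ φ) {k l : ℕ}
    (h : k ≠ l) (a b : A) : φ (factor A k a * factor A l b) = ρ a * ρ b := by
  have h' := ((isProductState_iff hρ).1 hφ).2 {l, k} fun j => if j = k then a else b
  rw [factorProd_insert (by simpa using h.symm), Finset.prod_pair h.symm] at h'
  simpa [factorProd, h.symm, mul_comm] using h'

/-- Cross terms contain the factor `ρ b = 0`, so growth is linear in the number of sites rather than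
quadratic. -/
theorem IsProductState.map_star_sum_mul_sum (hρ : ρ 1 = 1) (hφ : IsProductState ρ φ) {b : A}
    (hb : ρ b = 0) (s : Finset ℕ) :
    φ (star (∑ k ∈ s, factor A k b) * ∑ k ∈ s, factor A k b) = s.card * ρ (star b * b) := by
  rw [star_sum, Finset.sum_mul_sum, map_sum, ← nsmul_eq_mul]
  refine Finset.sum_eq_card_nsmul fun k hk => ?_
  rw [map_sum, Finset.sum_eq_single_of_mem k hk fun l _ hl => ?_]
  · rw [← map_star, ← map_mul, hφ.map_factor hρ]
  · rw [← map_star, hφ.map_factor_mul_factor hρ hl.symm, hb, mul_zero]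

/-- The transposition of `k` and `l` is a finite permutation fixing every site of `s`. -/
theorem map_factorProd_mul_factor_eq (hφ : φ ∈ symmetricStates A) {s : Finset ℕ} {k l : ℕ}
    (hk : k ∉ s) (hl : l ∉ s) (a : ℕ → A) (b : A) :
    φ (factorProd s a * factor A k b) = φ (factorProd s a * factor A l b) := by
  have hfin : {j | Equiv.swap k l j ≠ j}.Finite :=
    (Set.toFinite {k, l}).subset fun j hj => by
      by_contra h
      simp only [Set.mem_insert_iff, Set.mem_singleton_iff, not_or] at h
      exact hj (Equiv.swap_apply_of_ne_of_ne h.1 h.2)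
  rw [← hφ.2 _ hfin (factorProd s a * factor A k b), map_mul, permAct_factor,
    Equiv.swap_apply_left, permAct_factorProd_of_fixed]
  exact fun j hj => Equiv.swap_apply_of_ne_of_ne (fun h => hk (h ▸ hj)) fun h => hl (h ▸ hj)

/-- A symmetric state dominated by a multiple of a product state `ρ ⊗ ρ ⊗ ⋯` is that state. -/
theorem eq_of_le_smul_isProductState (hρ : ρ 1 = 1) (hφ : IsProductState ρ φ)
    (hψ : ψ ∈ symmetricStates A) {C : ℝ}
    (hC : ∀ x, (ψ (star x * x)).re ≤ C * (φ (star x * x)).re) : ψ = φ := by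
  have key : ∀ (s : Finset ℕ) (a : ℕ → A) (k : ℕ) (b : A), k ∉ s → ρ b = 0 →
      ψ (factorProd s a * factor A k b) = 0 := by
    intro s a k b hk hb
    by_contra hne
    set y := factorProd s a
    set c := ψ (y * factor A k b) with hc
    obtain ⟨m, hm⟩ := s.exists_nat_subset_range
    set D := (ψ (star (star y) * star y)).re
    have hD : 0 ≤ D := (Complex.nonneg_iff.1 (hψ.1.2 _)).1
    have bound : ∀ N : ℕ, (N * ‖c‖) ^ 2 ≤ D * (C * (N * (ρ (star b * b)).re)) := by
      intro N
      -- These `N` sites avoid `s`, which lies below `m`.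
      set z := ∑ l ∈ Finset.Ico m (m + N), factor A l b with hz
      have h1 : ψ (star (star y) * z) = N * c := by
        rw [star_star, hz, Finset.mul_sum, map_sum, Finset.sum_congr rfl fun l hl =>
          (map_factorProd_mul_factor_eq hψ hk (fun h => ?_) a b).symm]
        · simp [hc, y]
        · have := Finset.mem_range.1 (hm h)
          have := (Finset.mem_Ico.1 hl).1
          omega
      have h2 := hψ.1.norm_map_star_mul_sq_le (star y) z
      rw [h1, norm_mul, Complex.norm_natCast] at h2
      refine h2.trans (mul_le_mul_of_nonneg_left ((hC z).trans_eq ?_) hD)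
      rw [hz, hφ.map_star_sum_mul_sum hρ hb]
      simp
    have hpos : 0 < ‖c‖ ^ 2 := by positivity
    obtain ⟨N, hN⟩ := exists_nat_gt (D * (C * (ρ (star b * b)).re) / ‖c‖ ^ 2)
    rw [div_lt_iff₀ hpos] at hN
    -- Using `N + 1` instead of `N` makes the cancelled factor strictly positive.
    have h := bound (N + 1)
    push_cast at h
    have hN' : (0 : ℝ) < N + 1 := by positivity
    have h3 : ((N : ℝ) + 1) * ((N + 1) * ‖c‖ ^ 2) ≤
        (N + 1) * (D * (C * (ρ (star b * b)).re)) := by linarith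
    have h4 := le_of_mul_le_mul_left h3 hN'
    linarith
  refine hψ.1.ext_factorProd hφ.1 fun s a => ?_
  rw [((isProductState_iff hρ).1 hφ).2]
  induction s using Finset.induction_on with
  | empty => simpa using hψ.1.1
  | insert k s hk ih =>
    -- The centred part of `a k` contributes nothing, so `a k` may be replaced by the scalar `ρ (a
    -- k)`.
    have h := key s a k (a k - ρ (a k) • 1) hk (by simp [hρ])
    rw [map_sub, map_smul, map_one, mul_sub, map_sub, sub_eq_zero, mul_smul_comm, mul_one,
      map_smul, smul_eq_mul, ih] at h
    rw [factorProd_insert hk, h, Finset.prod_insert hk]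

theorem IsProductState.mem_extremePoints (hρ : ρ 1 = 1) (hφ : IsProductState ρ φ) :
    φ ∈ Set.extremePoints ℝ (symmetricStates A) := by
  refine ⟨hφ.mem_symmetricStates hρ, ?_⟩
  rintro φ₁ h₁ φ₂ h₂ ⟨t, u, ht, hu, _, rfl⟩
  -- Dropping the nonnegative term `u φ₂(x* x)` leaves `t φ₁(x* x) ≤ φ(x* x)`.
  refine eq_of_le_smul_isProductState (C := t⁻¹) hρ hφ h₁ fun x => ?_
  have h := (Complex.nonneg_iff.1 (h₂.1.2 x)).1
  rw [inv_mul_eq_div, le_div_iff₀ ht]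
  simp only [LinearMap.add_apply, LinearMap.smul_apply, Complex.add_re, Complex.smul_re,
    smul_eq_mul]
  nlinarith [mul_nonneg hu.le h]

end InfTensor

end

theorem mainTheorem6 {n : ℕ} (A : StarSubalgebra ℂ (Matrix (Fin n) (Fin n) ℂ))
    (ρ : A →ₗ[ℂ] ℂ) (hρ : InfTensor.IsState ρ) :
    (∃! φ : InfTensor.infTensor A →ₗ[ℂ] ℂ, InfTensor.IsProductState ρ φ) ∧
      ∀ φ : InfTensor.infTensor A →ₗ[ℂ] ℂ, InfTensor.IsProductState ρ φ →
        φ ∈ Set.extremePoints ℝ (InfTensor.symmetricStates A) := by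
  obtain ⟨φ, hφ⟩ := InfTensor.exists_isProductState hρ
  exact ⟨⟨φ, hφ, fun ψ hψ => hψ.unique hρ.1 hφ⟩, fun ψ hψ => hψ.mem_extremePoints hρ.1⟩
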